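/- Let $n=15$. For $x\in\mathbb F_2^n$ and $\pi\in S_n$ let $(x,\pi)$ denote the transformation $y\mapsto x+\pi(y)$ of $\mathbb F_2^n$, where $\pi(y)=(y_{\pi(1)},\dots,y_{\pi(n)})$; let $\mathrm{Aut}(\mathbb F_2^n)$ be the group of all these transformations under composition, and for a code $C\subseteq\mathbb F_2^n$ let $\mathrm{Aut}(C)$ be the setwise stabilizer of $C$ in $\mathrm{Aut}(\mathbb F_2^n)$. A subgroup $G\le\mathrm{Aut}(C)$ is called regular if it acts transitively on the codewords of $C$ and $|G|=|C|$. For $G\le\mathrm{Aut}(\mathbb F_2^n)$ put $\Pi_G=\{\pi\in S_n:(x,\pi)\in G\text{ for some }x\}$; a subgroup $H\le \mathrm{Aut}(\mathbb F_2^n)$ is narrow-sense embedded in $G$ if $H\le G$ and $\Pi_H=\Pi_G$. Let $\mathcal H_{15}$ be the binary Hamming code of length $15$, whose parity-check matrix has as columns all the nonzero vectors of $\mathbb F_2^4$ (the $i$-th column being the binary expansion of $i$, $1\le i\le 15$), and let $\mathcal A_{15}$ be its dual, the linear Hadamard code of length $15$, dimension $4$ and minimum distance $8$. Let $\mathcal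 E$ be the set of regular subgroups $G$ of $\mathrm{Aut}(\mathcal H_{15})$ such that some regular subgroup $H$ of $\mathrm{Aut}(\mathcal A_{15})$ is narrow-sense embedded in $G$. Then the members of $\mathcal E$ lie in at least $1207$ conjugacy classes of subgroups of $\mathrm{Aut}(\mathcal H_{15})$, and they fall into at least $48$ isomorphism classes of groups. -/

import Mathlib

open scoped Pointwise

/-- The binary vector space `F_2^n`. -/
abbrev Word (n : ℕ) : Type := Fin n → ZMod 2

/-- The transformation `(x, π)` of `F_2^n`: it sends `y` to `x + π(y)`, where
`π(y) = (y_{π(1)}, …, y_{π(n)})`. -/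
def wordAut {n : ℕ} (x : Word n) (π : Equiv.Perm (Fin n)) : Equiv.Perm (Word n) where
  toFun y := x + fun i => y (π i)
  invFun z := fun i => (z - x) (π.symm i)
  left_inv y := by
    funext i
    simp
  right_inv z := by
    funext i
    simp

/-- `Aut(F_2^n)`: the group, under composition, of all transformations `(x, π)`. -/
def autSpace (n : ℕ) : Subgroup (Equiv.Perm (Word n)) where
  carrier := {f | ∃ (x : Word n) (π : Equiv.Perm (Fin n)), f = wordAut x π}
  one_mem' := by
    refine ⟨0, 1, ?_⟩
    ext y i
    simp [wordAut]
  mul_mem' := by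
    rintro _ _ ⟨x, π, rfl⟩ ⟨x', π', rfl⟩
    refine ⟨x + fun i => x' (π i), π' * π, ?_⟩
    ext y i
    simp [wordAut, add_assoc]
  inv_mem' := by
    rintro _ ⟨x, π, rfl⟩
    refine ⟨fun i => - x (π⁻¹ i), π⁻¹, ?_⟩
    rw [inv_eq_iff_mul_eq_one]
    ext y i
    simp [wordAut, ← add_assoc, CharTwo.add_self_eq_zero]

/-- `Aut(C)`: the setwise stabilizer of the code `C` in `Aut(F_2^n)`. -/
def autCode {n : ℕ} (C : Set (Word n)) : Subgroup (Equiv.Perm (Word n)) :=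
  autSpace n ⊓ MulAction.stabilizer (Equiv.Perm (Word n)) C

/-- `G` is a regular subgroup of `Aut(C)`: it acts transitively on the codewords of `C`, and its
order is the size of `C`. -/
def IsRegularSubgroup {n : ℕ} (C : Set (Word n)) (G : Subgroup (Equiv.Perm (Word n))) : Prop :=
  G ≤ autCode C ∧ (∀ c ∈ C, ∀ d ∈ C, ∃ g ∈ G, g c = d) ∧ Nat.card G = Nat.card C

/-- `Π_G = {π : (x, π) ∈ G for some x}`. -/
def permPart {n : ℕ} (G : Subgroup (Equiv.Perm (Word n))) : Set (Equiv.Perm (Fin n)) :=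
  {π | ∃ x : Word n, wordAut x π ∈ G}

/-- `H` is narrow-sense embedded in `G`. -/
def NarrowSenseEmbedded {n : ℕ} (H G : Subgroup (Equiv.Perm (Word n))) : Prop :=
  H ≤ G ∧ permPart G = permPart H

/-- The `r × (2^r - 1)` matrix over `F_2` whose columns are all the nonzero vectors of `F_2^r`:
the `i`-th column consists of the binary digits of `i + 1`, for `0 ≤ i < 2^r - 1`. -/
def hammingMatrix (r : ℕ) : Matrix (Fin r) (Fin (2 ^ r - 1)) (ZMod 2) :=
  Matrix.of fun j i => if (i.val + 1).testBit j.val then 1 else 0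

/-- The Hamming code `H_n` of length `n = 2^r - 1`. -/
def hammingCode (r : ℕ) : Submodule (ZMod 2) (Word (2 ^ r - 1)) :=
  LinearMap.ker (hammingMatrix r).mulVecLin

/-- The linear Hadamard code `A_n` of length `n = 2^r - 1`, the dual of the Hamming code: its
codewords are the value vectors `c_a = (⟨a, x⟩)_x`, `a ∈ F_2^r`, of the linear functionals on the
nonzero vectors `x` of `F_2^r`. -/
def hadamardCode (r : ℕ) : Submodule (ZMod 2) (Word (2 ^ r - 1)) :=
  LinearMap.range (hammingMatrix r).vecMulLinear

/-- Conjugacy of subgroups under the elements of the subgroup `A`. -/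
def conjSetoid {Γ : Type*} [Group Γ] (A : Subgroup Γ) : Setoid (Subgroup Γ) where
  r G G' := ∃ g ∈ A, G' = G.map (MulAut.conj g).toMonoidHom
  iseqv :=
    { refl := fun G => ⟨1, A.one_mem, by
        ext x
        simp⟩
      symm := by
        rintro G _ ⟨g, hg, rfl⟩
        refine ⟨g⁻¹, A.inv_mem hg, ?_⟩
        ext x
        simp [Subgroup.mem_map, mul_assoc]
      trans := by
        rintro G _ _ ⟨g, hg, rfl⟩ ⟨h, hh, rfl⟩
        refine ⟨h * g, A.mul_mem hh hg, ?_⟩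
        ext x
        simp [Subgroup.mem_map, mul_assoc] }

/-- Isomorphism of subgroups, as abstract groups. -/
def isoSetoid (Γ : Type*) [Group Γ] : Setoid (Subgroup Γ) where
  r G G' := Nonempty (G ≃* G')
  iseqv :=
    { refl := fun G => ⟨MulEquiv.refl G⟩
      symm := fun ⟨e⟩ => ⟨e.symm⟩
      trans := fun ⟨e⟩ ⟨f⟩ => ⟨e.trans f⟩ }

/-- The regular subgroups of `Aut(H_n)`, `n = 2^r - 1`, in which some regular subgroup of `Aut(A_n)`
is narrow-sense embedded. -/
def embeddingRegularSubgroups (r : ℕ) : Set (Subgroup (Equiv.Perm (Word (2 ^ r - 1)))) :=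
  {G | IsRegularSubgroup (hammingCode r : Set (Word (2 ^ r - 1))) G ∧
    ∃ H, IsRegularSubgroup (hadamardCode r : Set (Word (2 ^ r - 1))) H ∧ NarrowSenseEmbedded H G}

/-- The conjugacy classes in `Aut(H_n)` that contain a member of `embeddingRegularSubgroups r`. -/
def embeddingConjClasses (r : ℕ) :
    Set (Quotient (conjSetoid (autCode (hammingCode r : Set (Word (2 ^ r - 1)))))) :=
  Quotient.mk _ '' embeddingRegularSubgroups r

/-- The isomorphism classes of the groups in `embeddingRegularSubgroups r`. -/
def embeddingIsoClasses (r : ℕ) :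
    Set (Quotient (isoSetoid (Equiv.Perm (Word (2 ^ r - 1))))) :=
  Quotient.mk _ '' embeddingRegularSubgroups r

/-!
The codewords of `H_15` are the polynomials of degree at most two on `F_2^4`, restricted to the
nonzero vectors, and `A_15` consists of the linear forms among them. If `σ` maps codewords to
coordinate permutations preserving `H_15` and is multiplicative along `x + σ(x)(y)`, then
`{(x, σ(x)) : x ∈ H_15}` is a regular subgroup of `Aut(H_15)`; its part over `A_15` is a regular
subgroup of `Aut(A_15)` if the values of `σ` preserve `A_15`, and is narrow-sense embedded if `σ`
takes all its values on `A_15` (`graphGroup_mem_embeddingRegularSubgroups`). Here `σ(x)` always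
depends only on `p(x)`, for a linear map `p` from `H_15` to some `F_2^e`.

*Conjugacy classes.* Let the values of `σ` be the eight transvections `v ↦ v + v₃ u`. They do not
move the hyperplane `v₃ = 0`, so any `p` that depends only on the values of the polynomial on the
hyperplane (and at `0`, which is the sum of the entries of the word) is admissible. This gives a
family of `2^12` groups with the same `σ` as a function of `p`. A coordinate permutation that
conjugates one of these groups into another one is linear, preserves the hyperplane, and induces on
it an isometry of the bilinear form that matches `p(x)` with `u` (`Linked.block_mem`); the isometry
and the first group determine the second group (`Linked.eq_of_block_eq`). For the form chosen here
there are only three isometries, so the family meets at least `4096 / 3 > 1207` classes.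

*Isomorphism classes.* The numbers of pairs `(x, y)` of group elements with `x² = y²`, with `x² = 1`
and `xy = yx`, and with `x² = y² = 1` and `xy = yx`, are isomorphism invariants. On pairs of
codewords with given values of `p` each of these conditions is a system of linear equations over
`F_2`, because squares and commutators of `(x, σ(x))` are linear in `x` there. The solutions are
counted by Gaussian elimination (`countSolutions`), and the three numbers together take 48 different
values on 48 explicit groups (`nodup_invariants_representatives`).
-/

namespace HammingRegular

/-! ### Regular subgroups as graphs -/

section Graph

variable {n : ℕ}

theorem wordAut_apply (x : Word n) (π : Equiv.Perm (Fin n)) (y : Word n) :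
    wordAut x π y = x + y ∘ π := rfl

theorem wordAut_mul (x x' : Word n) (π π' : Equiv.Perm (Fin n)) :
    wordAut x π * wordAut x' π' = wordAut (x + x' ∘ π) (π' * π) := by
  ext y i
  simp [wordAut_apply, add_assoc]

theorem wordAut_inj {x x' : Word n} {π π' : Equiv.Perm (Fin n)} :
    wordAut x π = wordAut x' π' ↔ x = x' ∧ π = π' := by
  refine ⟨fun h => ?_, by rintro ⟨rfl, rfl⟩; rfl⟩
  have hx : x = x' := by simpa [wordAut_apply] using congrArg (· 0) h
  subst hx
  refine ⟨rfl, Equiv.ext fun i => ?_⟩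
  have h1 := congrFun (congrArg (· (Pi.single (π i) 1)) h) i
  by_contra hne
  simp [wordAut_apply, Ne.symm hne] at h1

/-- A map `σ` from words to coordinate permutations whose values preserve `C` and which is
multiplicative along the twisted addition `x ⋆ y = x + σ(x)(y)` of `C`. Such maps are what
regular subgroups of `Aut(C)` amount to: see `graphGroup`. -/
structure IsCrossed (C : Submodule (ZMod 2) (Word n)) (σ : Word n → Equiv.Perm (Fin n)) :
    Prop where
  mem : ∀ x ∈ C, ∀ y ∈ C, y ∘ σ x ∈ C
  mul : ∀ x ∈ C, ∀ y ∈ C, σ (x + y ∘ σ x) = σ y * σ x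

variable {C : Submodule (ZMod 2) (Word n)} {σ : Word n → Equiv.Perm (Fin n)}

theorem IsCrossed.map_zero (h : IsCrossed C σ) : σ 0 = 1 := by
  have := h.mul 0 C.zero_mem 0 C.zero_mem
  simpa using this

/-- The group `{(x, σ(x)) : x ∈ C}` of transformations. -/
def graphGroup (h : IsCrossed C σ) : Subgroup (Equiv.Perm (Word n)) where
  carrier := {f | ∃ x ∈ C, f = wordAut x (σ x)}
  one_mem' := ⟨0, C.zero_mem, by ext y i; simp [wordAut_apply, h.map_zero]⟩
  mul_mem' := by
    rintro _ _ ⟨x, hx, rfl⟩ ⟨y, hy, rfl⟩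
    exact ⟨_, C.add_mem hx (h.mem x hx y hy), by rw [wordAut_mul, h.mul x hx y hy]⟩
  inv_mem' := by
    rintro _ ⟨x, hx, rfl⟩
    -- The group of all permutations is finite, so an inverse is a power.
    have key : ∀ k : ℕ, ∃ y ∈ C, wordAut x (σ x) ^ k = wordAut y (σ y) := by
      intro k
      induction k with
      | zero => exact ⟨0, C.zero_mem, by ext y i; simp [wordAut_apply, h.map_zero]⟩
      | succ k ih =>
        obtain ⟨y, hy, e⟩ := ih
        exact ⟨_, C.add_mem hy (h.mem y hy x hx), by rw [pow_succ, e, wordAut_mul, h.mul y hy x hx]⟩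
    obtain ⟨y, hy, e⟩ := key (orderOf (wordAut x (σ x)) - 1)
    refine ⟨y, hy, ?_⟩
    rw [← e]
    refine inv_eq_of_mul_eq_one_right ?_
    rw [← pow_succ', Nat.sub_add_cancel (orderOf_pos _), pow_orderOf_eq_one]

theorem graphGroup_maps (h : IsCrossed C σ) {f : Equiv.Perm (Word n)} (hf : f ∈ graphGroup h)
    {y : Word n} (hy : y ∈ C) : f y ∈ C := by
  obtain ⟨x, hx, rfl⟩ := hf
  exact C.add_mem hx (h.mem x hx y hy)

/-- The group `{(x, σ(x)) : x ∈ C}` is parametrized by `C`. -/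
noncomputable def graphEquiv (h : IsCrossed C σ) : C ≃ graphGroup h :=
  Equiv.ofBijective (fun x => ⟨wordAut x (σ x), x, x.2, rfl⟩)
    ⟨fun _ _ e => Subtype.ext (wordAut_inj.1 (congrArg Subtype.val e)).1,
      fun ⟨_, x, hx, e⟩ => ⟨⟨x, hx⟩, Subtype.ext e.symm⟩⟩

theorem isRegularSubgroup_graphGroup (h : IsCrossed C σ) :
    IsRegularSubgroup (C : Set (Word n)) (graphGroup h) := by
  refine ⟨fun f hf => ⟨?_, ?_⟩, fun c hc d hd => ?_, (Nat.card_congr (graphEquiv h)).symm⟩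
  · obtain ⟨x, -, rfl⟩ := hf
    exact ⟨x, _, rfl⟩
  · refine MulAction.mem_stabilizer_iff.2 (Set.Subset.antisymm ?_ ?_)
    · rintro _ ⟨y, hy, rfl⟩
      exact graphGroup_maps h hf hy
    · intro y hy
      exact ⟨f⁻¹ y, graphGroup_maps h (inv_mem hf) hy, by simp⟩
  · refine ⟨wordAut d (σ d) * (wordAut c (σ c))⁻¹,
      mul_mem ⟨d, hd, rfl⟩ ((graphGroup h).inv_mem ⟨c, hc, rfl⟩), ?_⟩
    have h0 : ∀ z : Word n, wordAut z (σ z) 0 = z := fun z => by simp [wordAut_apply]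
    have hc0 : (wordAut c (σ c))⁻¹ c = 0 := by
      rw [Equiv.Perm.inv_eq_iff_eq, h0]
    rw [Equiv.Perm.mul_apply, hc0, h0]

theorem permPart_graphGroup (h : IsCrossed C σ) : permPart (graphGroup h) = σ '' C := by
  ext π
  constructor
  · rintro ⟨x, y, hy, e⟩
    exact ⟨y, hy, (wordAut_inj.1 e).2.symm⟩
  · rintro ⟨x, hx, rfl⟩
    exact ⟨x, x, hx, rfl⟩

/-- The regular subgroup of `Aut(A_n)` inside `{(x, σ(x)) : x ∈ H_n}` is the part over `A_n`; it is
narrow-sense embedded as soon as `σ` takes all its values on `A_n`. -/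
theorem graphGroup_mem_embeddingRegularSubgroups {r : ℕ}
    {σ : Word (2 ^ r - 1) → Equiv.Perm (Fin (2 ^ r - 1))} (h : IsCrossed (hammingCode r) σ)
    (hle : hadamardCode r ≤ hammingCode r)
    (hA : ∀ x ∈ hadamardCode r, ∀ y ∈ hadamardCode r, y ∘ σ x ∈ hadamardCode r)
    (hσ : ∀ x ∈ hammingCode r, ∃ a ∈ hadamardCode r, σ a = σ x) :
    graphGroup h ∈ embeddingRegularSubgroups r := by
  have hc : IsCrossed (hadamardCode r) σ :=
    ⟨hA, fun x hx y hy => h.mul x (hle hx) y (hle hy)⟩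
  refine ⟨isRegularSubgroup_graphGroup h, graphGroup hc, isRegularSubgroup_graphGroup hc, ?_, ?_⟩
  · rintro _ ⟨x, hx, rfl⟩
    exact ⟨x, hle hx, rfl⟩
  · rw [permPart_graphGroup, permPart_graphGroup]
    refine Set.Subset.antisymm ?_ (Set.image_mono hle)
    rintro _ ⟨x, hx, rfl⟩
    obtain ⟨a, ha, e⟩ := hσ x hx
    exact ⟨a, ha, e⟩

end Graph

/-- The Hamming code of length 15, over the index type `Fin 15`. -/
def hamming15 : Submodule (ZMod 2) (Word 15) := hammingCode 4

/-- The linear Hadamard code of length 15, over the index type `Fin 15`. -/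
def hadamard15 : Submodule (ZMod 2) (Word 15) := hadamardCode 4

/-- The `j`-th coordinate of the `i`-th nonzero vector of `F_2^4`. -/
def coord (j : Fin 4) (i : Fin 15) : ZMod 2 := hammingMatrix 4 j i

theorem mem_hamming15 {y : Word 15} : y ∈ hamming15 ↔ ∀ j, ∑ i, coord j i * y i = 0 := by
  show Matrix.mulVec (hammingMatrix 4) y = 0 ↔ _
  rw [funext_iff]
  rfl

theorem mem_hadamard15 {y : Word 15} :
    y ∈ hadamard15 ↔ ∃ a : Fin 4 → ZMod 2, ∀ i, ∑ j, a j * coord j i = y i := by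
  show (∃ a, Matrix.vecMul a (hammingMatrix 4) = y) ↔ _
  simp only [funext_iff]
  rfl

/-- The rows of the parity-check matrix are pairwise orthogonal and have even weight. -/
theorem sum_coord_mul_coord : ∀ j k, ∑ i, coord j i * coord k i = 0 := by
  decide +kernel

theorem hadamard15_le_hamming15 : hadamard15 ≤ hamming15 := by
  intro y hy
  obtain ⟨a, ha⟩ := mem_hadamard15.1 hy
  refine mem_hamming15.2 fun j => ?_
  simp_rw [← ha, Finset.mul_sum]
  rw [Finset.sum_comm]
  refine Finset.sum_eq_zero fun k _ => ?_
  have := congrArg (a k * ·) (sum_coord_mul_coord j k)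
  simp only [mul_zero, Finset.mul_sum] at this
  rw [← this]
  exact Finset.sum_congr rfl fun i _ => by ring

theorem coord_injective : ∀ i k : Fin 15, (∀ j, coord j i = coord j k) → i = k := by
  decide +kernel

theorem graphGroup_mem {σ : Word 15 → Equiv.Perm (Fin 15)} (h : IsCrossed hamming15 σ)
    (hA : ∀ x ∈ hadamard15, ∀ y ∈ hadamard15, y ∘ σ x ∈ hadamard15)
    (hσ : ∀ x ∈ hamming15, ∃ a ∈ hadamard15, σ a = σ x) :
    graphGroup h ∈ embeddingRegularSubgroups 4 :=
  graphGroup_mem_embeddingRegularSubgroups (r := 4) h hadamard15_le_hamming15 hA hσ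

/-! ### A family of groups with transvections as coordinate permutations -/

/-- The transvection `v ↦ v + v₃ u` of `F_2^4`, `u ∈ F_2^3`, as a permutation of the nonzero
vectors. The vector with binary expansion `i + 1` has index `i`, so that the hyperplane `v₃ = 0`
consists of the indices `i < 7`. -/
def transvection (u : Fin 3 → ZMod 2) : Equiv.Perm (Fin 15) where
  toFun i := if i.val < 7 then i else
    Fin.ofNat 15 (((i.val + 1) ^^^ ((u 0).val + 2 * (u 1).val + 4 * (u 2).val)) - 1)
  invFun i := if i.val < 7 then i else
    Fin.ofNat 15 (((i.val + 1) ^^^ ((u 0).val + 2 * (u 1).val + 4 * (u 2).val)) - 1)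
  left_inv := by revert u; decide +kernel
  right_inv := by revert u; decide +kernel

theorem transvection_add (u v : Fin 3 → ZMod 2) :
    transvection (u + v) = transvection v * transvection u := by
  have : ∀ u v : Fin 3 → ZMod 2, ∀ i,
      transvection (u + v) i = transvection v (transvection u i) := by decide +kernel
  exact Equiv.ext (this u v)

theorem transvection_zero : transvection 0 = 1 := by
  have : ∀ i, transvection 0 i = i := by decide +kernel
  exact Equiv.ext this

theorem transvection_fix : ∀ (u : Fin 3 → ZMod 2) (i : Fin 15), i.val < 7 → transvection u i = i := by
  decide +kernel

theorem transvection_ne : ∀ (u : Fin 3 → ZMod 2) (i : Fin 15), u ≠ 0 → ¬ i.val < 7 →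
    transvection u i ≠ i := by
  decide +kernel

theorem transvection_inv (u : Fin 3 → ZMod 2) : (transvection u)⁻¹ = transvection u := by
  rw [inv_eq_iff_mul_eq_one, ← transvection_add, CharTwo.add_self_eq_zero, transvection_zero]

theorem coord_last : ∀ i : Fin 15, coord 3 i = if i.val < 7 then 0 else 1 := by
  decide +kernel

theorem coord_transvection : ∀ (u : Fin 3 → ZMod 2) (i : Fin 15) (j : Fin 4),
    coord j (transvection u i) =
      coord j i + (Fin.snoc u 0 : Fin 4 → ZMod 2) j * coord 3 i := by
  decide +kernel

theorem comp_transvection_mem_hamming15 (u : Fin 3 → ZMod 2) {y : Word 15}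
    (hy : y ∈ hamming15) : y ∘ transvection u ∈ hamming15 := by
  rw [mem_hamming15] at hy ⊢
  intro j
  have h1 : ∀ i, coord j i * (y ∘ transvection u) i =
      (fun i => coord j ((transvection u)⁻¹ i) * y i) (transvection u i) :=
    fun i => by simp
  simp_rw [h1]
  rw [Equiv.sum_comp (transvection u) (fun i => coord j ((transvection u)⁻¹ i) * y i),
    transvection_inv]
  simp_rw [coord_transvection, add_mul, mul_assoc]
  rw [Finset.sum_add_distrib, ← Finset.mul_sum, hy, hy, mul_zero, add_zero]

theorem comp_transvection_mem_hadamard15 (u : Fin 3 → ZMod 2) {y : Word 15}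
    (hy : y ∈ hadamard15) : y ∘ transvection u ∈ hadamard15 := by
  obtain ⟨a, ha⟩ := mem_hadamard15.1 hy
  refine mem_hadamard15.2
    ⟨fun j => a j + if j = 3 then ∑ k, a k * (Fin.snoc u 0 : Fin 4 → ZMod 2) k else 0, fun i => ?_⟩
  simp only [Function.comp_apply, ← ha, coord_transvection]
  simp only [add_mul, mul_add, Finset.sum_add_distrib, ite_mul, zero_mul, Finset.sum_ite_eq',
    Finset.mem_univ, if_true, Finset.sum_mul, mul_assoc]

/-- The indices of the first three unit vectors of `F_2^4`. -/
def unitIndex : Fin 3 → Fin 15 := ![0, 1, 3]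

/-- A codeword of `H_15` is a polynomial `ℓ + ε + Σ q_ab x_a x_b` of degree at most two on
`F_2^4`, restricted to the nonzero vectors; the sum of its entries is its value at `0`. This is the
linear map to `F_2^3` that sends it to `(ℓ₀, ℓ₁, ℓ₂) + ε (φ₀ + (1, 1, 1)) + q₀₁ φ₁ + q₀₂ φ₂ + q₁₂ φ₃`,
written through the values of the polynomial on the hyperplane `v₃ = 0` and at `0`. -/
def proj (φ : Fin 4 → Fin 3 → ZMod 2) (x : Word 15) : Fin 3 → ZMod 2 := fun j =>
  x (unitIndex j) + (∑ i, x i) * φ 0 j + (x 0 + x 1 + x 2 + ∑ i, x i) * φ 1 j +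
    (x 0 + x 3 + x 4 + ∑ i, x i) * φ 2 j + (x 1 + x 3 + x 5 + ∑ i, x i) * φ 3 j

theorem proj_add (φ : Fin 4 → Fin 3 → ZMod 2) (x y : Word 15) :
    proj φ (x + y) = proj φ x + proj φ y := by
  funext j
  simp only [proj, Pi.add_apply, Finset.sum_add_distrib]
  ring

theorem proj_comp (φ : Fin 4 → Fin 3 → ZMod 2) (x : Word 15) {ρ : Equiv.Perm (Fin 15)}
    (hρ : ∀ i : Fin 15, i.val < 7 → ρ i = i) : proj φ (x ∘ ρ) = proj φ x := by
  funext j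
  have h : ∑ i, (x ∘ ρ) i = ∑ i, x i := Equiv.sum_comp ρ x
  have hj : ρ (unitIndex j) = unitIndex j := hρ _ (by revert j; decide)
  simp only [proj, h]
  simp only [Function.comp_apply, hj, hρ 0 (by decide), hρ 1 (by decide), hρ 2 (by decide),
    hρ 3 (by decide), hρ 4 (by decide), hρ 5 (by decide)]

/-- On the linear forms `Σ a_j x_j` all the maps `proj φ` read off `(a₀, a₁, a₂)`. -/
theorem proj_hadamard (φ : Fin 4 → Fin 3 → ZMod 2) (a : Fin 4 → ZMod 2) :
    proj φ (fun i => ∑ j, a j * coord j i) = fun j => a j.castSucc := by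
  have h : ∀ a : Fin 4 → ZMod 2, (∑ i : Fin 15, ∑ j, a j * coord j i = 0) ∧
      (∀ k : Fin 3, ∑ j, a j * coord j (unitIndex k) = a k.castSucc) ∧
      (∑ j, a j * coord j 0 + ∑ j, a j * coord j 1 +
        ∑ j, a j * coord j 2 = 0) ∧
      (∑ j, a j * coord j 0 + ∑ j, a j * coord j 3 +
        ∑ j, a j * coord j 4 = 0) ∧
      (∑ j, a j * coord j 1 + ∑ j, a j * coord j 3 +
        ∑ j, a j * coord j 5 = 0) := by decide +kernel
  obtain ⟨h1, h2, h3, h4, h5⟩ := h a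
  funext j
  simp only [proj, h1, h2, h3, h4, h5]
  ring

/-- The cyclic shift of coordinates, the bilinear form on `F_2^3` by which the classes of linear
forms are matched with the transvections. It is not symmetric and has only three isometries. -/
def twist (w : Fin 3 → ZMod 2) : Fin 3 → ZMod 2 := fun l => w (l + 1)

theorem twist_add (v w : Fin 3 → ZMod 2) : twist (v + w) = twist v + twist w := rfl

theorem isCrossed_transvection (φ : Fin 4 → Fin 3 → ZMod 2) :
    IsCrossed (hamming15) fun x : Word 15 => transvection (twist (proj φ x)) where
  mem x _ y hy := comp_transvection_mem_hamming15 _ hy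
  mul x _ y _ := by
    show transvection (twist (proj φ (x + y ∘ _))) = _
    rw [proj_add, proj_comp φ y (transvection_fix _), twist_add, transvection_add]

/-- The regular subgroup of `Aut(H_15)` with parameter `φ` in a family of `2^12` such groups, with
the same eight coordinate permutations. -/
def transvectionGroup (φ : Fin 4 → Fin 3 → ZMod 2) : Subgroup (Equiv.Perm (Word 15)) :=
  graphGroup (isCrossed_transvection φ)

theorem transvectionGroup_mem (φ : Fin 4 → Fin 3 → ZMod 2) :
    transvectionGroup φ ∈ embeddingRegularSubgroups 4 := by
  refine graphGroup_mem (isCrossed_transvection φ)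
    (fun x _ y hy => comp_transvection_mem_hadamard15 _ hy)
    fun x _ => ⟨fun i => ∑ j, (Fin.snoc (proj φ x) 0 : Fin 4 → ZMod 2) j * coord j i,
      mem_hadamard15.2 ⟨_, fun i => rfl⟩, ?_⟩
  show transvection (twist (proj φ _)) = transvection (twist (proj φ x))
  rw [proj_hadamard]
  simp

/-- Conjugacy of two groups of the family, in terms of coordinate permutations alone. -/
def Linked (φ φ' : Fin 4 → Fin 3 → ZMod 2) (π : Equiv.Perm (Fin 15)) : Prop :=
  (∀ y : Word 15, y ∈ hamming15 ↔ y ∘ π ∈ hamming15) ∧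
  ∀ x : Word 15, x ∈ hamming15 →
    transvection (twist (proj φ x)) * π = π * transvection (twist (proj φ' (x ∘ π)))

theorem exists_linked {φ φ' : Fin 4 → Fin 3 → ZMod 2}
    (h : (conjSetoid (autCode (hamming15 : Set (Word 15)))).r
      (transvectionGroup φ) (transvectionGroup φ')) :
    ∃ π, Linked φ φ' π := by
  obtain ⟨g, ⟨⟨b, π, rfl⟩, hs⟩, hG⟩ := h
  have hs : wordAut b π • (hamming15 : Set (Word 15)) = hamming15 := MulAction.mem_stabilizer_iff.1 hs
  have hmap : ∀ y : Word 15, y ∈ hamming15 ↔ b + y ∘ π ∈ hamming15 := fun y => by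
    have h1 : wordAut b π • y ∈ wordAut b π • (hamming15 : Set (Word 15)) ↔
        y ∈ (hamming15 : Set (Word 15)) := Set.smul_mem_smul_set_iff
    rw [hs] at h1
    exact h1.symm
  have hb : b ∈ hamming15 := by
    have h0 := (hmap 0).1 (Submodule.zero_mem _)
    have h00 : ((0 : Word 15) ∘ π) = 0 := rfl
    rwa [h00, add_zero] at h0
  refine ⟨π, fun y => (hmap y).trans (Submodule.add_mem_iff_right _ hb), fun x hx => ?_⟩
  have hmem : wordAut b π * wordAut x (transvection (twist (proj φ x))) * (wordAut b π)⁻¹ ∈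
      transvectionGroup φ' := by
    rw [hG]
    exact ⟨_, ⟨x, hx, rfl⟩, rfl⟩
  obtain ⟨x', -, e⟩ := hmem
  rw [mul_inv_eq_iff_eq_mul, wordAut_mul, wordAut_mul, wordAut_inj] at e
  obtain ⟨e1, e2⟩ := e
  have hp : proj φ' x' = proj φ' (x ∘ π) := by
    have := congrArg (proj φ') e1
    rw [proj_add, proj_add, proj_comp φ' b (transvection_fix _), add_comm (proj φ' x')] at this
    exact (add_left_cancel this).symm
  rw [e2]
  simp only [hp]


section Linked

variable {φ φ' φ'' : Fin 4 → Fin 3 → ZMod 2} {π π' : Equiv.Perm (Fin 15)}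

theorem coord_mem_hamming15 (a : Fin 4 → ZMod 2) :
    (fun i => ∑ j, a j * coord j i : Word 15) ∈ hamming15 :=
  hadamard15_le_hamming15 (mem_hadamard15.2 ⟨a, fun _ => rfl⟩)

/-- The hyperplane `v₃ = 0` is preserved, being the fixed-point set of every nontrivial
transvection. -/
theorem Linked.lt_seven_iff (h : Linked φ φ' π) (i : Fin 15) : (π i).val < 7 ↔ i.val < 7 := by
  have h1 := h.2 _ (coord_mem_hamming15 fun _ => 1)
  rw [proj_hadamard] at h1
  set u := twist fun _ => (1 : ZMod 2) with hu
  set u' := twist (proj φ' _) with hu'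
  have hu0 : u ≠ 0 := by rw [hu]; decide
  have hu0' : u' ≠ 0 := by
    intro h0
    rw [h0, transvection_zero, mul_one, mul_eq_right] at h1
    exact transvection_ne u 7 hu0 (by decide) (by rw [h1]; rfl)
  have h2 : transvection u (π i) = π (transvection u' i) := congrArg (· i) h1
  constructor
  · intro hi
    rw [transvection_fix u _ hi] at h2
    by_contra hi'
    exact transvection_ne u' i hu0' hi' (π.injective h2).symm
  · intro hi
    rw [transvection_fix u' _ hi] at h2
    by_contra hi'
    exact transvection_ne u _ hu0 hi' h2

theorem Linked.coord_three (h : Linked φ φ' π) (i : Fin 15) : coord 3 (π i) = coord 3 i := by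
  rw [coord_last, coord_last, if_congr (h.lt_seven_iff i) rfl rfl]

/-- The indices of the unit vectors of `F_2^4`. -/
def basisIndex : Fin 4 → Fin 15 := ![0, 1, 3, 7]

/-- A coordinate permutation preserving the Hamming code is linear on `F_2^4`: the weight-three
and weight-four codewords `e_i + Σ_k v_k(i) e_{i_k}` record the linear dependences. -/
theorem Linked.linear (h : Linked φ φ' π) (j : Fin 4) (i : Fin 15) :
    coord j (π i) = ∑ k, coord j (π (basisIndex k)) * coord k i := by
  have hy : ∀ i j, ∑ l, coord j l * ((Pi.single i 1 : Word 15) l +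
      ∑ k, coord k i * (Pi.single (basisIndex k) 1 : Word 15) l) = 0 := by decide +kernel
  set y : Word 15 := fun l => (Pi.single i 1 : Word 15) l +
      ∑ k, coord k i * (Pi.single (basisIndex k) 1 : Word 15) l with hydef
  have h1 : y ∘ π.symm ∈ hamming15 := by
    rw [h.1]
    have : (y ∘ π.symm) ∘ π = y := by ext; simp
    rw [this]
    exact mem_hamming15.2 (hy i)
  have h2 := mem_hamming15.1 h1 j
  rw [← Equiv.sum_comp π] at h2
  simp only [Function.comp_apply, Equiv.symm_apply_apply, hydef, mul_add, Finset.mul_sum,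
    Finset.sum_add_distrib] at h2
  rw [Finset.sum_comm] at h2
  have h3 : ∀ k, ∑ l, coord j (π l) * (coord k i * (Pi.single (basisIndex k) 1 : Word 15) l) =
      coord j (π (basisIndex k)) * coord k i := fun k => by
    simp [Pi.single_apply]
  simp only [h3] at h2
  simp only [Pi.single_apply, mul_ite, mul_one, mul_zero, Finset.sum_ite_eq',
    Finset.mem_univ, if_true] at h2
  exact CharTwo.add_eq_zero.1 h2

/-- The matrix of `π` on the hyperplane `v₃ = 0`. -/
def block (π : Equiv.Perm (Fin 15)) : Fin 3 → Fin 3 → ZMod 2 :=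
  fun j k => coord j.castSucc (π (unitIndex k))

/-- Conjugation by `π` acts on the transvection vectors by the matrix `block π`. -/
theorem Linked.block_mul (h : Linked φ φ' π) {x : Word 15} (hx : x ∈ hamming15) (k : Fin 3) :
    ∑ l, block π k l * twist (proj φ' (x ∘ π)) l = twist (proj φ x) k := by
  have h1 : transvection (twist (proj φ x)) (π 7) = π (transvection (twist (proj φ' (x ∘ π))) 7) :=
    congrArg (· 7) (h.2 x hx)
  have h2 := congrArg (coord k.castSucc) h1
  have h7 : coord 3 7 = 1 := by decide
  rw [h.linear _ (transvection _ _), coord_transvection, h.coord_three, h7, mul_one,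
    Fin.snoc_castSucc] at h2
  simp only [coord_transvection, h7, mul_one, mul_add, Finset.sum_add_distrib] at h2
  rw [← h.linear, add_left_cancel_iff, Fin.sum_univ_castSucc] at h2
  simp only [Fin.snoc_castSucc, Fin.snoc_last, mul_zero, add_zero] at h2
  rw [h2]
  refine Finset.sum_congr rfl fun l _ => ?_
  have : ∀ l : Fin 3, basisIndex l.castSucc = unitIndex l := by decide
  rw [this]
  rfl

/-- The isometries of the bilinear form `Σ_l v_l w_{l+1}` on `F_2^3`. -/
def isometries : Finset (Fin 3 → Fin 3 → ZMod 2) :=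
  Finset.univ.filter fun m => ∀ j k, ∑ l, m k l * m j (l + 1) = if k + 1 = j then 1 else 0

theorem card_isometries : isometries.card = 3 := by
  decide +kernel

theorem eq_zero_of_mem_isometries : ∀ m ∈ isometries, ∀ v : Fin 3 → ZMod 2,
    (∀ k, ∑ l, m k l * v l = 0) → v = 0 := by
  decide +kernel

theorem Linked.block_mem (h : Linked φ φ' π) : block π ∈ isometries := by
  refine Finset.mem_filter.2 ⟨Finset.mem_univ _, fun j k => ?_⟩
  have h1 := h.block_mul (coord_mem_hamming15 (Pi.single j.castSucc 1)) k
  have h2 : (fun i => ∑ l, (Pi.single j.castSucc 1 : Fin 4 → ZMod 2) l * coord l i : Word 15) ∘ π =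
      fun i => ∑ l, coord j.castSucc (π (basisIndex l)) * coord l i := by
    funext i
    rw [← h.linear]
    simp [Pi.single_apply]
  rw [h2, proj_hadamard, proj_hadamard] at h1
  have h3 : ∀ l : Fin 3, basisIndex l.castSucc = unitIndex l := by decide
  simp only [twist, h3] at h1
  rw [show (∑ l, block π k l * block π j (l + 1)) = _ from h1]
  simp [Pi.single_apply]

/-- Codewords of `H_15` on which `proj φ` takes the values `φ₀, …, φ₃`, up to constants: the
polynomials `1`, `x₀x₁`, `x₀x₂`, `x₁x₂`. -/
def testWord : Fin 4 → Word 15 :=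
  ![fun _ => 1, fun i => coord 0 i * coord 1 i, fun i => coord 0 i * coord 2 i,
    fun i => coord 1 i * coord 2 i]

theorem eq_of_proj_eq (h : ∀ z ∈ hamming15, proj φ z = proj φ' z) : φ = φ' := by
  have hm : ∀ t, testWord t ∈ hamming15 := fun t => by
    have : ∀ t j, ∑ i, coord j i * testWord t i = 0 := by decide +kernel
    exact mem_hamming15.2 (this t)
  have hp : ∀ (φ : Fin 4 → Fin 3 → ZMod 2) t j,
      proj φ (testWord t) j = testWord t (unitIndex j) + φ t j := by
    intro φ t j
    have h1 : ∀ t, (∑ i, testWord t i = if t = 0 then 1 else 0) ∧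
        (testWord t 0 + testWord t 1 + testWord t 2 + ∑ i, testWord t i = if t = 1 then 1 else 0) ∧
        (testWord t 0 + testWord t 3 + testWord t 4 + ∑ i, testWord t i = if t = 2 then 1 else 0) ∧
        (testWord t 1 + testWord t 3 + testWord t 5 + ∑ i, testWord t i = if t = 3 then 1 else 0) := by
      decide +kernel
    obtain ⟨a, b, c, d⟩ := h1 t
    simp only [proj, b, c, d]
    rw [a]
    fin_cases t <;> simp
  funext t j
  have := congrFun (h _ (hm t)) j
  rw [hp, hp] at this
  exact add_left_cancel this

/-- Among the groups conjugate to `transvectionGroup φ`, the matrix on the hyperplane of a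
conjugating permutation determines the group: two permutations with the same matrix differ by a
permutation fixing the hyperplane pointwise, to which the maps `proj` are blind. -/
theorem Linked.eq_of_block_eq (h : Linked φ φ' π) (h' : Linked φ φ'' π')
    (hb : block π = block π') : φ' = φ'' := by
  have hagree : ∀ i : Fin 15, i.val < 7 → π i = π' i := by
    intro i hi
    refine coord_injective _ _ fun j => ?_
    induction j using Fin.lastCases with
    | last => exact (h.coord_three i).trans (h'.coord_three i).symm
    | cast j =>
      have h3 : ∀ l : Fin 3, basisIndex l.castSucc = unitIndex l := by decide
      have hs : ∀ f : Fin 4 → ZMod 2, ∑ k, f k = ∑ k : Fin 3, f k.castSucc + f (Fin.last 3) :=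
        fun f => Fin.sum_univ_castSucc f
      rw [h.linear, h'.linear, hs, hs]
      have h4 : coord (Fin.last 3) i = 0 := (coord_last i).trans (if_pos hi)
      rw [h4, mul_zero, mul_zero]
      congr 1
      refine Finset.sum_congr rfl fun l _ => ?_
      rw [h3]
      exact congrArg (· * _) (congrFun (congrFun hb j) l)
  refine eq_of_proj_eq fun z hz => ?_
  set x : Word 15 := z ∘ π.symm with hx
  have hxz : x ∘ π = z := by rw [hx]; ext; simp
  have hxm : x ∈ hamming15 := by rwa [h.1, hxz]
  have hxz' : x ∘ π' = z ∘ (π⁻¹ * π' : Equiv.Perm (Fin 15)) := by rw [hx]; rfl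
  have hp : proj φ'' (x ∘ π') = proj φ'' z := by
    rw [hxz']
    refine proj_comp _ _ fun i hi => ?_
    rw [Equiv.Perm.mul_apply, ← hagree i hi]
    simp
  have h1 := fun k => (h.block_mul hxm k).trans (h'.block_mul hxm k).symm
  rw [hp, hxz, hb] at h1
  have h2 := eq_zero_of_mem_isometries _ h'.block_mem
    (twist (proj φ' z) - twist (proj φ'' z)) fun k => by
      simp only [Pi.sub_apply, mul_sub, Finset.sum_sub_distrib, h1, sub_self]
  have h3 := sub_eq_zero.1 h2
  funext l
  have := congrFun h3 (l - 1)
  simpa [twist] using this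

end Linked

/-- The conjugacy class in `Aut(H_15)` of a group of the family. -/
def familyClass (φ : Fin 4 → Fin 3 → ZMod 2) :
    Quotient (conjSetoid (autCode (hammingCode 4 : Set (Word (2 ^ 4 - 1))))) :=
  Quotient.mk _ (transvectionGroup φ)

open Classical in
/-- Each conjugacy class contains at most three groups of the family. -/
theorem card_familyClass_fiber_le (φ₀ : Fin 4 → Fin 3 → ZMod 2) :
    (Finset.univ.filter fun φ => familyClass φ = familyClass φ₀).card ≤ 3 := by
  have hl : ∀ φ, familyClass φ = familyClass φ₀ → ∃ π, Linked φ₀ φ π :=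
    fun φ hφ => exists_linked (Quotient.exact hφ.symm)
  choose! f hf using hl
  refine le_of_le_of_eq ?_ card_isometries
  refine Finset.card_le_card_of_injOn (fun φ => block (f φ))
    (fun φ hφ => (hf φ (Finset.mem_filter.1 hφ).2).block_mem) fun φ hφ φ' hφ' e => ?_
  exact (hf φ (Finset.mem_filter.1 hφ).2).eq_of_block_eq (hf φ' (Finset.mem_filter.1 hφ').2) e

theorem le_ncard_embeddingConjClasses : 1207 ≤ (embeddingConjClasses 4).ncard := by
  classical
  have h1 : (Finset.univ : Finset (Fin 4 → Fin 3 → ZMod 2)).card ≤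
      3 * (Finset.univ.image familyClass).card := by
    refine Finset.card_le_mul_card_image _ 3 fun Q hQ => ?_
    obtain ⟨φ₀, -, rfl⟩ := Finset.mem_image.1 hQ
    convert card_familyClass_fiber_le φ₀
  have h2 : (Finset.univ : Finset (Fin 4 → Fin 3 → ZMod 2)).card = 4096 := by
    simp [Fintype.card_pi, ZMod.card]
  have h3 : (↑(Finset.univ.image familyClass) : Set _) ⊆ embeddingConjClasses 4 := by
    intro Q hQ
    obtain ⟨φ, -, rfl⟩ := Finset.mem_image.1 (Finset.mem_coe.1 hQ)
    exact ⟨_, transvectionGroup_mem φ, rfl⟩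
  have h4 := Set.ncard_le_ncard h3 (Set.toFinite _)
  rw [Set.ncard_coe_finset] at h4
  omega

/-! ### Linear maps over `F_2` in binary notation -/

/-- The combination, with respect to bitwise exclusive or, of the numbers in a list whose
coefficients are the binary digits of `c`. It stands for the `F_2`-linear map with the given list
of columns, vectors over `F_2` being encoded by numbers. -/
def xorComb : List ℕ → ℕ → ℕ
  | [], _ => 0
  | r :: rs, c => (bif c.testBit 0 then r else 0) ^^^ xorComb rs (c / 2)

theorem xorComb_cons_two_mul (r : ℕ) (rs : List ℕ) (c : ℕ) :
    xorComb (r :: rs) (2 * c) = xorComb rs c := by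
  simp [xorComb]

theorem xorComb_cons_two_mul_add_one (r : ℕ) (rs : List ℕ) (c : ℕ) :
    xorComb (r :: rs) (2 * c + 1) = r ^^^ xorComb rs c := by
  have : (2 * c + 1) / 2 = c := by omega
  simp [xorComb, this]

theorem xorComb_induction {p : ℕ → Prop} (h0 : p 0) (hx : ∀ a b, p a → p b → p (a ^^^ b)) :
    ∀ {rs : List ℕ}, (∀ r ∈ rs, p r) → ∀ c, p (xorComb rs c)
  | [], _, _ => h0
  | r :: rs, h, c => by
    refine hx _ _ ?_ (xorComb_induction h0 hx (fun s hs => h s (List.mem_cons_of_mem _ hs)) _)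
    cases c.testBit 0
    · exact h0
    · exact h r List.mem_cons_self

theorem xorComb_lt {rs : List ℕ} {k : ℕ} (h : ∀ r ∈ rs, r < 2 ^ k) (c : ℕ) :
    xorComb rs c < 2 ^ k :=
  xorComb_induction (p := (· < 2 ^ k)) (Nat.two_pow_pos k) (fun _ _ => Nat.xor_lt_two_pow) h c

theorem xorComb_xor : ∀ (rs : List ℕ) (a b : ℕ),
    xorComb rs (a ^^^ b) = xorComb rs a ^^^ xorComb rs b
  | [], _, _ => (Nat.xor_self 0).symm
  | r :: rs, a, b => by
    have h : (a ^^^ b) / 2 = a / 2 ^^^ b / 2 := by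
      simpa using Nat.xor_div_two_pow (a := a) (b := b) (n := 1)
    rw [xorComb, xorComb, xorComb, h, xorComb_xor rs, Nat.testBit_xor]
    generalize xorComb rs (a / 2) = x
    generalize xorComb rs (b / 2) = y
    have h2 : r ^^^ x ^^^ (r ^^^ y) = x ^^^ y := by
      rw [Nat.xor_comm r x, Nat.xor_assoc, ← Nat.xor_assoc r r y, Nat.xor_self, Nat.zero_xor]
    cases a.testBit 0 <;> cases b.testBit 0 <;>
      simp [h2, Nat.xor_assoc, Nat.xor_left_comm]

theorem xorComb_map {f : ℕ → ℕ} (hf : ∀ a b, f (a ^^^ b) = f a ^^^ f b) :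
    ∀ (rs : List ℕ) (c : ℕ), xorComb (rs.map f) c = f (xorComb rs c) := by
  have h0 : f 0 = 0 := by simpa using hf 0 0
  intro rs
  induction rs with
  | nil => exact fun _ => h0.symm
  | cons r rs ih =>
    intro c
    rw [List.map_cons, xorComb, xorComb, ih, hf]
    cases c.testBit 0 <;> simp [h0]

theorem xorComb_zipWith {f : ℕ → ℕ → ℕ} (hf : ∀ a b a' b', f (a ^^^ a') (b ^^^ b') = f a b ^^^ f a' b') :
    ∀ {rs ss : List ℕ}, rs.length = ss.length → ∀ c : ℕ,
      xorComb (List.zipWith f rs ss) c = f (xorComb rs c) (xorComb ss c) := by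
  have h0 : f 0 0 = 0 := by simpa using hf 0 0 0 0
  intro rs
  induction rs with
  | nil =>
    intro ss hs c
    rw [List.length_eq_zero_iff.1 (hs.symm.trans List.length_nil)]
    exact h0.symm
  | cons r rs ih =>
    intro ss hs c
    cases ss with
    | nil => simp at hs
    | cons s ss =>
      rw [List.zipWith_cons_cons, xorComb, xorComb, xorComb, ih (by simpa using hs), hf]
      cases c.testBit 0 <;> simp [h0]

/-- The columns of the identity map of `F_2^11`. -/
def units : List ℕ := [1, 2, 4, 8, 16, 32, 64, 128, 256, 512, 1024]

theorem xorComb_units {c : ℕ} (hc : c < 2048) : xorComb units c = c := by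
  have key : ∀ n, ∀ c < 2 ^ n, xorComb ((List.range n).map (2 ^ ·)) c = c := by
    intro n
    induction n with
    | zero => intro c hc; rw [pow_zero, Nat.lt_one_iff] at hc; rw [hc]; rfl
    | succ n ih =>
      intro c hc
      have h1 : (List.range (n + 1)).map (2 ^ ·) = 1 :: ((List.range n).map (2 ^ ·)).map (2 * ·) := by
        rw [List.range_succ_eq_map, List.map_cons, List.map_map, List.map_map]
        congr 1
        refine List.map_congr_left fun a _ => ?_
        simp [pow_succ, mul_comm]
      have hadd : ∀ a b : ℕ, 2 * (a ^^^ b) = 2 * a ^^^ 2 * b := fun a b => by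
        simpa [Nat.shiftLeft_eq, mul_comm] using Nat.shiftLeft_xor_distrib (a := a) (b := b) (i := 1)
      rw [h1]
      obtain ⟨d, rfl | rfl⟩ := Nat.even_or_odd' c
      · rw [xorComb_cons_two_mul, xorComb_map hadd, ih d (by rw [pow_succ] at hc; omega)]
      · rw [xorComb_cons_two_mul_add_one, xorComb_map hadd, ih d (by rw [pow_succ] at hc; omega)]
        have h2 := Nat.xor_div_two_pow (a := 1) (b := 2 * d) (n := 1)
        have h3 := Nat.xor_mod_two_pow (a := 1) (b := 2 * d) (n := 1)
        rw [pow_one, Nat.mul_div_cancel_left d two_pos, Nat.zero_xor] at h2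
        rw [pow_one, Nat.mul_mod_right, Nat.xor_zero] at h3
        omega
  exact key 11 c hc

/-! ### Counting the solutions of linear systems -/

/-- The number of ways to write `t` as a combination of the numbers in the list. -/
def solutions : List ℕ → ℕ → ℕ
  | [], t => if t = 0 then 1 else 0
  | r :: rs, t => solutions rs t + solutions rs (r ^^^ t)

theorem sum_range_two_mul (f : ℕ → ℕ) (m : ℕ) :
    ∑ c ∈ Finset.range (2 * m), f c = ∑ c ∈ Finset.range m, (f (2 * c) + f (2 * c + 1)) := by
  induction m with
  | zero => rfl
  | succ m ih =>
    rw [Finset.sum_range_succ, ← ih, mul_add, mul_one, Finset.sum_range_succ, Finset.sum_range_succ,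
      add_assoc]

theorem solutions_append (ss : List ℕ) : ∀ (rs : List ℕ) (t : ℕ), solutions (rs ++ ss) t =
    ∑ c ∈ Finset.range (2 ^ rs.length), solutions ss (xorComb rs c ^^^ t)
  | [], t => by simp [xorComb]
  | r :: rs, t => by
    rw [List.cons_append, solutions, solutions_append ss rs, solutions_append ss rs,
      List.length_cons, pow_succ', sum_range_two_mul, Finset.sum_add_distrib]
    simp_rw [xorComb_cons_two_mul, xorComb_cons_two_mul_add_one]
    congr 1
    refine Finset.sum_congr rfl fun c _ => ?_
    rw [← Nat.xor_assoc, Nat.xor_comm _ r]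

theorem solutions_append_eq_sum (rs ss : List ℕ) (t : ℕ) : solutions (rs ++ ss) t =
    ∑ c ∈ Finset.range (2 ^ rs.length), ∑ d ∈ Finset.range (2 ^ ss.length),
      if xorComb rs c ^^^ xorComb ss d = t then 1 else 0 := by
  rw [solutions_append]
  refine Finset.sum_congr rfl fun c _ => ?_
  have h := solutions_append [] ss (xorComb rs c ^^^ t)
  rw [List.append_nil] at h
  rw [h]
  refine Finset.sum_congr rfl fun d _ => ?_
  refine if_congr ?_ rfl rfl
  rw [← Nat.xor_assoc, Nat.xor_eq_zero_iff, Nat.xor_comm]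

/-- The same number by Gaussian elimination: the leading binary digit of a nonzero `r` is cleared
in the remaining columns and in the right-hand side, and determines the coefficient of `r`. The
first argument bounds the number of columns. -/
def countSolutions : ℕ → List ℕ → ℕ → ℕ
  | _, [], t => bif Nat.beq t 0 then 1 else 0
  | 0, _ :: _, _ => 0
  | n + 1, r :: rs, t =>
    bif Nat.beq r 0 then 2 * countSolutions n rs t else
      countSolutions n (rs.map fun a => bif a.testBit r.log2 then a ^^^ r else a)
        (bif t.testBit r.log2 then t ^^^ r else t)

/-- Clearing a digit of `r` in all columns leaves the solutions in which `r` may occur or not. -/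
theorem solutions_map_clear {r k : ℕ} (hk : r.testBit k = true) : ∀ (rs : List ℕ) (t : ℕ),
    solutions (rs.map fun a => bif a.testBit k then a ^^^ r else a)
      (bif t.testBit k then t ^^^ r else t) = solutions rs t + solutions rs (r ^^^ t)
  | [], t => by
    have hr : r ≠ 0 := by rintro rfl; simp at hk
    have h1 : r ^^^ t = 0 ↔ t = r := by rw [Nat.xor_eq_zero_iff]; exact eq_comm
    have h2 : t ^^^ r = 0 ↔ t = r := Nat.xor_eq_zero_iff
    simp only [List.map_nil, solutions, h1]
    cases ht : t.testBit k
    · have h3 : t ≠ r := by rintro rfl; simp [hk] at ht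
      simp [h3]
    · have h3 : t ≠ 0 := by rintro rfl; simp at ht
      simp [h2, h3]
  | a :: rs, t => by
    have h1 : (bif a.testBit k then a ^^^ r else a) ^^^ (bif t.testBit k then t ^^^ r else t) =
        bif (a ^^^ t).testBit k then (a ^^^ t) ^^^ r else a ^^^ t := by
      rw [Nat.testBit_xor]
      cases a.testBit k <;> cases t.testBit k <;>
        simp [Nat.xor_assoc, Nat.xor_comm r, Nat.xor_comm a t, Nat.xor_left_comm]
    rw [List.map_cons, solutions, h1, solutions_map_clear hk rs, solutions_map_clear hk rs,
      solutions, solutions, Nat.xor_left_comm a r t]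
    ring

theorem countSolutions_eq : ∀ (n : ℕ) (rs : List ℕ) (t : ℕ), rs.length ≤ n →
    countSolutions n rs t = solutions rs t
  | n, [], t, _ => by
    have : countSolutions n [] t = bif Nat.beq t 0 then 1 else 0 := by cases n <;> rfl
    rw [this, solutions]
    by_cases h : t = 0
    · subst h; rfl
    · rw [if_neg h, show Nat.beq t 0 = false from Bool.eq_false_iff.2 fun e => h (Nat.eq_of_beq_eq_true e)]; rfl
  | 0, _ :: _, _, h => absurd h (by simp)
  | n + 1, r :: rs, t, h => by
    have hl : rs.length ≤ n := by simpa using h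
    rw [countSolutions]
    by_cases hr : r = 0
    · subst hr
      rw [countSolutions_eq n rs t hl, solutions, Nat.zero_xor, two_mul]
      rfl
    · rw [show Nat.beq r 0 = false from Bool.eq_false_iff.2 fun e => hr (Nat.eq_of_beq_eq_true e), cond_false,
        countSolutions_eq n _ _ (by rwa [List.length_map]),
        solutions_map_clear (Nat.testBit_log2 hr), solutions]

/-- Pairs `(x, y)` of vectors as one vector; `x` has to be shorter than `k`. -/
def pack (k x y : ℕ) : ℕ := x ^^^ (y <<< k)

theorem pack_xor (k x y x' y' : ℕ) : pack k (x ^^^ x') (y ^^^ y') = pack k x y ^^^ pack k x' y' := by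
  simp only [pack, Nat.shiftLeft_xor_distrib]
  ac_rfl

theorem pack_inj {k x y x' y' : ℕ} (hx : x < 2 ^ k) (hx' : x' < 2 ^ k) :
    pack k x y = pack k x' y' ↔ x = x' ∧ y = y' := by
  have key : ∀ a b, a < 2 ^ k → pack k a b % 2 ^ k = a ∧ pack k a b / 2 ^ k = b := by
    intro a b ha
    rw [pack, Nat.xor_mod_two_pow, Nat.xor_div_two_pow, Nat.shiftLeft_eq, Nat.mul_mod_left,
      Nat.mul_div_cancel _ (Nat.two_pow_pos k), Nat.mod_eq_of_lt ha, Nat.div_eq_of_lt ha,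
      Nat.xor_zero, Nat.zero_xor]
    exact ⟨rfl, rfl⟩
  refine ⟨fun h => ?_, by rintro ⟨rfl, rfl⟩; rfl⟩
  have h1 := key x y hx
  have h2 := key x' y' hx'
  rw [h] at h1
  exact ⟨h1.1.symm.trans h2.1, h1.2.symm.trans h2.2⟩

/-- The columns of the system `p(c) = w`, `p(d) = v`, `A(c) = B(d)` in the unknowns `c`, `d`, the
maps `p`, `A`, `B` being given by their columns. -/
def pairSystem (P A B : List ℕ) : List ℕ :=
  List.zipWith (fun p a => pack 3 p (pack 3 0 a)) P A ++
    List.zipWith (fun p b => pack 3 0 (pack 3 p b)) P B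

theorem countSolutions_pairSystem {P A B : List ℕ} (hP : P.length = 11) (hA : A.length = 11)
    (hB : B.length = 11) (hp : ∀ r ∈ P, r < 2 ^ 3) {w v : ℕ} (hw : w < 2 ^ 3) (hv : v < 2 ^ 3) :
    countSolutions 22 (pairSystem P A B) (pack 3 w (pack 3 v 0)) =
      ∑ c ∈ Finset.range 2048, ∑ d ∈ Finset.range 2048,
        if xorComb P c = w ∧ xorComb P d = v ∧ xorComb A c = xorComb B d then 1 else 0 := by
  have hl1 : (List.zipWith (fun p a => pack 3 p (pack 3 0 a)) P A).length = 11 := by simp [hP, hA]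
  have hl2 : (List.zipWith (fun p b => pack 3 0 (pack 3 p b)) P B).length = 11 := by simp [hP, hB]
  have hz : ∀ a b a' b', pack 3 (a ^^^ a') (pack 3 0 (b ^^^ b')) =
      pack 3 a (pack 3 0 b) ^^^ pack 3 a' (pack 3 0 b') := fun a b a' b' => by
    rw [← pack_xor, ← pack_xor, Nat.xor_zero]
  have hz' : ∀ a b a' b', pack 3 0 (pack 3 (a ^^^ a') (b ^^^ b')) =
      pack 3 0 (pack 3 a b) ^^^ pack 3 0 (pack 3 a' b') := fun a b a' b' => by
    rw [← pack_xor, ← pack_xor, Nat.xor_zero]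
  rw [countSolutions_eq _ _ _ (by rw [pairSystem, List.length_append, hl1, hl2]), pairSystem,
    solutions_append_eq_sum, hl1, hl2]
  refine Finset.sum_congr rfl fun c _ => Finset.sum_congr rfl fun d _ => if_congr ?_ rfl rfl
  rw [xorComb_zipWith hz (hP.trans hA.symm), xorComb_zipWith hz' (hP.trans hB.symm), ← pack_xor,
    ← pack_xor, Nat.xor_zero, Nat.zero_xor, pack_inj (xorComb_lt hp c) hw,
    pack_inj (xorComb_lt hp d) hv, Nat.xor_eq_zero_iff]

/-! ### The Hamming code in coordinates -/

/-- The values of the polynomials `x₀, x₁, x₂, x₃, 1, x₀x₁, x₀x₂, x₀x₃, x₁x₂, x₁x₃, x₂x₃` at the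
nonzero vectors of `F_2^4`, as binary numbers. -/
def monomials : List ℕ :=
  [0x5555, 0x6666, 0x7878, 0x7f80, 0x7fff, 0x4444, 0x5050, 0x5500, 0x6060, 0x6600, 0x7800]

/-- The word of values of the polynomial of degree at most two with coefficients the digits of
`c < 2^11`, in the order of `monomials`. -/
def word (c : ℕ) : Word 15 := fun i => if (xorComb monomials c).testBit i then 1 else 0

theorem word_xor (a b : ℕ) : word (a ^^^ b) = word a + word b := by
  funext i
  simp only [word, Pi.add_apply, xorComb_xor, Nat.testBit_xor]
  cases (xorComb monomials a).testBit i <;> cases (xorComb monomials b).testBit i <;> decide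

theorem word_mem_hamming15 {c : ℕ} (hc : c < 2048) : word c ∈ hamming15 := by
  rw [← xorComb_units hc]
  refine xorComb_induction (p := fun c => word c ∈ hamming15) ?_ (fun a b ha hb => ?_) ?_ c
  · have : word 0 = 0 := by funext i; revert i; decide +kernel
    rw [this]
    exact hamming15.zero_mem
  · rw [word_xor]
    exact hamming15.add_mem ha hb
  · have : ∀ r ∈ units, ∀ j, ∑ i, coord j i * word r i = 0 := by decide +kernel
    exact fun r hr => mem_hamming15.2 (this r hr)

/-- The columns of a linear map that recovers the coefficients from the values. -/
def decoder : List ℕ :=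
  [0x71e, 0x4dd, 0x7df, 0x2bb, 0x7bf, 0x6ff, 0x7ff, 0x688, 0x80, 0x200, 0, 0x400, 0, 0, 0]

theorem eq_of_word_eq {c d : ℕ} (hc : c < 2048) (hd : d < 2048) (h : word c = word d) : c = d := by
  have hlt : ∀ r ∈ monomials, r < 2 ^ 15 := by decide
  have h1 : xorComb monomials c = xorComb monomials d := by
    refine Nat.eq_of_testBit_eq fun i => ?_
    by_cases hi : i < 15
    · have := congrFun h ⟨i, hi⟩
      simp only [word] at this
      revert this
      cases (xorComb monomials c).testBit i <;> cases (xorComb monomials d).testBit i <;> simp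
    · have hle : 2 ^ 15 ≤ 2 ^ i := Nat.pow_le_pow_right two_pos (not_lt.1 hi)
      rw [Nat.testBit_lt_two_pow ((xorComb_lt hlt c).trans_le hle),
        Nat.testBit_lt_two_pow ((xorComb_lt hlt d).trans_le hle)]
  have hdec : ∀ c < 2048, xorComb decoder (xorComb monomials c) = c := fun c hc => by
    rw [← xorComb_map (xorComb_xor decoder)]
    exact xorComb_units hc
  rw [← hdec c hc, h1, hdec d hd]

theorem card_hamming15 : Nat.card hamming15 = 2048 := by
  let f : Word 15 →ₗ[ZMod 2] Fin 4 → ZMod 2 := (Matrix.of coord).mulVecLin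
  have hker : LinearMap.ker f = hamming15 := rfl
  have hf : Function.Surjective f := fun a => by
    refine ⟨fun i => ∑ k, a k * (Pi.single (basisIndex k) 1 : Word 15) i, ?_⟩
    have : ∀ a : Fin 4 → ZMod 2, ∀ j, ∑ i, coord j i *
        ∑ k, a k * (Pi.single (basisIndex k) 1 : Word 15) i = a j := by decide +kernel
    exact funext (this a)
  have h1 := LinearMap.finrank_range_add_finrank_ker f
  rw [LinearMap.range_eq_top.2 hf, finrank_top, hker] at h1
  simp only [Module.finrank_fintype_fun_eq_card, Fintype.card_fin] at h1
  have h2 := Module.natCard_eq_pow_finrank (K := ZMod 2) (V := hamming15)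
  rw [Nat.card_zmod, show Module.finrank (ZMod 2) hamming15 = 11 by omega] at h2
  exact h2

/-- The codewords of `H_15` are numbered by `0, …, 2047`. -/
noncomputable def wordEquiv : Fin 2048 ≃ hamming15 :=
  Equiv.ofBijective (fun c => ⟨word c, word_mem_hamming15 c.2⟩)
    ((Nat.bijective_iff_injective_and_card _).2
      ⟨fun c d h => Fin.ext (eq_of_word_eq c.2 d.2 (congrArg Subtype.val h)), by
        rw [card_hamming15, Nat.card_fin]⟩)

/-- The number of a codeword. -/
noncomputable def code (x : Word 15) : ℕ := by
  classical exact if h : x ∈ hamming15 then (wordEquiv.symm ⟨x, h⟩ : Fin 2048) else 0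

theorem code_word {c : ℕ} (hc : c < 2048) : code (word c) = c := by
  rw [code, dif_pos (word_mem_hamming15 hc)]
  have : wordEquiv ⟨c, hc⟩ = ⟨word c, word_mem_hamming15 hc⟩ := rfl
  rw [← this, Equiv.symm_apply_apply]

theorem exists_word {x : Word 15} (hx : x ∈ hamming15) : ∃ c < 2048, word c = x := by
  obtain ⟨c, hc⟩ := wordEquiv.surjective ⟨x, hx⟩
  exact ⟨c, c.2, congrArg Subtype.val hc⟩

theorem word_mem_hadamard15 {c : ℕ} (hc : c < 16) : word c ∈ hadamard15 := by
  have : ∀ c < 16, ∃ a : Fin 4 → ZMod 2, ∀ i, ∑ j, a j * coord j i = word c i := by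
    have : ∀ c < 16, ∀ i, ∑ j : Fin 4, (if c.testBit j then 1 else 0) * coord j i = word c i := by
      decide +kernel
    exact fun c hc => ⟨_, this c hc⟩
  exact mem_hadamard15.2 (this c hc)

theorem exists_word_of_mem_hadamard15 {x : Word 15} (hx : x ∈ hadamard15) :
    ∃ c < 16, word c = x := by
  obtain ⟨a, ha⟩ := mem_hadamard15.1 hx
  have : ∀ a : Fin 4 → ZMod 2, ∃ c < 16, ∀ i, word c i = ∑ j, a j * coord j i := by decide +kernel
  obtain ⟨c, hc, h⟩ := this a
  exact ⟨c, hc, funext fun i => (h i).trans (ha i)⟩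

/-! ### Groups given by matrices and a projection -/

/-- A `4 × 4` matrix over `F_2` is encoded by a number with four hexadecimal digits, the lowest one
for the first row; the rows are linear forms. This is the `j`-th row. -/
def row (m j : ℕ) : ℕ := (m >>> (4 * j)) % 16

/-- The permutation of the nonzero vectors of `F_2^4` given by a matrix. -/
def pointMap (m : ℕ) (i : Fin 15) : Fin 15 :=
  let b := fun j => ((xorComb monomials (row m j)).testBit i).toNat
  Fin.ofNat 15 (b 0 + 2 * b 1 + 4 * b 2 + 8 * b 3 - 1)

/-- The coefficients of the product of two linear forms. -/
def formProd (a b : ℕ) : ℕ :=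
  let q := fun i j => ((a.testBit i && b.testBit j) ^^ (a.testBit j && b.testBit i)).toNat
  (a &&& b) + 32 * q 0 1 + 64 * q 0 2 + 128 * q 0 3 + 256 * q 1 2 + 512 * q 1 3 + 1024 * q 2 3

/-- The columns of the action of a matrix on polynomials of degree at most two, by substitution. -/
def columns (m : ℕ) : List ℕ :=
  let a := row m 0
  let b := row m 1
  let c := row m 2
  let d := row m 3
  [a, b, c, d, 16, formProd a b, formProd a c, formProd a d, formProd b c, formProd b d,
    formProd c d]

/-- The data for a regular group `{(x, σ(p(x))) : x ∈ H_15}`. Here `p` is a linear map to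
`F_2^dim` which on the linear form `Σ a_j x_j` reads off `a_j`, `j < dim`, and has the values
`quad` on `1, x₀x₁, x₀x₂, x₀x₃, x₁x₂, x₁x₃, x₂x₃`; and `σ(w)` is the `w`-th of the
matrices `mats`. -/
structure Datum where
  dim : ℕ
  mats : List ℕ
  quad : List ℕ

namespace Datum

variable (D : Datum)

/-- The columns of the projection. -/
def proj : List ℕ := units.take D.dim ++ List.replicate (4 - D.dim) 0 ++ D.quad

/-- The matrix with a given label. -/
def mat (w : ℕ) : ℕ := D.mats.getD w 0

/-- The action of the matrix with label `w` on polynomials. -/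
def act (w c : ℕ) : ℕ := xorComb (columns (D.mat w)) c

/-- The data do define a group. The conditions say that the matrices are invertible, that the
substitutions are compatible with the permutations of the points and preserve the linear forms, that
the fibres of the projection are permuted, and that `σ` is multiplicative along the product of the
labels. -/
def Valid : Prop :=
  (D.dim ≤ 3 ∧ D.quad.length = 7 ∧ (∀ r ∈ D.proj, r < 2 ^ D.dim) ∧
    ∀ w < 2 ^ D.dim, xorComb D.proj w = w) ∧
  ∀ w < 2 ^ D.dim,
    (∀ i k, pointMap (D.mat w) i = pointMap (D.mat w) k → i = k) ∧
    (∀ i : Fin 15, monomials.map (fun r => r.testBit (pointMap (D.mat w) i)) =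
      (columns (D.mat w)).map fun r => (xorComb monomials r).testBit i) ∧
    (∀ r ∈ columns (D.mat w), r < 2048) ∧
    (∀ a < 16, D.act w a < 16) ∧
    (columns (D.mat w)).map (xorComb D.proj) = D.proj.map (fun r => xorComb D.proj (D.act w r)) ∧
    ∀ v < 2 ^ D.dim, ∀ i, pointMap (D.mat (w ^^^ xorComb D.proj (D.act w v))) i =
      pointMap (D.mat v) (pointMap (D.mat w) i)

instance : Decidable D.Valid := by unfold Valid; infer_instance

end Datum

open Classical in
/-- The permutation of the nonzero vectors of `F_2^4` given by an invertible matrix. -/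
noncomputable def matPerm (m : ℕ) : Equiv.Perm (Fin 15) :=
  if h : Function.Injective (pointMap m) then
    Equiv.ofBijective _ (Finite.injective_iff_bijective.1 h) else 1

theorem matPerm_apply {m : ℕ} (h : ∀ i k, pointMap m i = pointMap m k → i = k) (i : Fin 15) :
    matPerm m i = pointMap m i := by
  have h' : Function.Injective (pointMap m) := fun i k => h i k
  rw [matPerm, dif_pos h']
  rfl

namespace Datum

variable {D : Datum}

theorem Valid.proj_lt (h : D.Valid) (c : ℕ) : xorComb D.proj c < 2 ^ D.dim :=
  xorComb_lt h.1.2.2.1 c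

theorem Valid.matPerm_apply (h : D.Valid) {w : ℕ} (hw : w < 2 ^ D.dim) (i : Fin 15) :
    matPerm (D.mat w) i = pointMap (D.mat w) i :=
  HammingRegular.matPerm_apply (h.2 w hw).1 i

theorem act_xor (w a b : ℕ) : D.act w (a ^^^ b) = D.act w a ^^^ D.act w b :=
  xorComb_xor _ a b

theorem Valid.act_lt (h : D.Valid) {w : ℕ} (hw : w < 2 ^ D.dim) (c : ℕ) : D.act w c < 2048 :=
  xorComb_lt (k := 11) (h.2 w hw).2.2.1 c

/-- Substitution in polynomials is permutation of their values. -/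
theorem Valid.word_act (h : D.Valid) {w : ℕ} (hw : w < 2 ^ D.dim) (c : ℕ) :
    word (D.act w c) = word c ∘ matPerm (D.mat w) := by
  have hbit : ∀ i a b : ℕ, ((a ^^^ b).testBit i).toNat = (a.testBit i).toNat ^^^ (b.testBit i).toNat := by
    intro i a b
    rw [Nat.testBit_xor]
    cases a.testBit i <;> cases b.testBit i <;> rfl
  funext i
  have h1 := congrArg (fun l => xorComb (l.map Bool.toNat) c) ((h.2 w hw).2.1 i)
  simp only [List.map_map] at h1
  have h2 := xorComb_map (f := fun r => (r.testBit (pointMap (D.mat w) i)).toNat) (hbit _) monomials c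
  have h3 := xorComb_map (f := fun r => ((xorComb monomials r).testBit i).toNat)
    (fun a b => by rw [xorComb_xor, hbit]) (columns (D.mat w)) c
  have h4 := (h2.symm.trans h1).trans h3
  have hinj : Function.Injective Bool.toNat := by decide
  have h5 := hinj h4
  rw [Function.comp_apply, h.matPerm_apply hw, word, word, h5]
  rfl

/-- The label of an image depends only on the label. -/
theorem Valid.proj_act (h : D.Valid) {w : ℕ} (hw : w < 2 ^ D.dim) {c : ℕ} :
    xorComb D.proj (D.act w c) = xorComb D.proj (D.act w (xorComb D.proj c)) := by
  have h1 := congrArg (xorComb · c) (h.2 w hw).2.2.2.2.1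
  beta_reduce at h1
  rw [xorComb_map (xorComb_xor D.proj), xorComb_map (f := fun r => xorComb D.proj (D.act w r))
    (fun a b => by rw [act_xor, xorComb_xor])] at h1
  exact h1

theorem Valid.matPerm_mul (h : D.Valid) {w v : ℕ} (hw : w < 2 ^ D.dim) (hv : v < 2 ^ D.dim) :
    matPerm (D.mat (w ^^^ xorComb D.proj (D.act w v))) = matPerm (D.mat v) * matPerm (D.mat w) := by
  refine Equiv.ext fun i => ?_
  rw [Equiv.Perm.mul_apply, h.matPerm_apply hw, h.matPerm_apply hv,
    h.matPerm_apply (Nat.xor_lt_two_pow hw (h.proj_lt _))]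
  exact (h.2 w hw).2.2.2.2.2 v hv i

/-- The product of the group elements numbered `c` and `d`. -/
def mul (D : Datum) (c d : ℕ) : ℕ := c ^^^ D.act (xorComb D.proj c) d

theorem Valid.mul_lt (h : D.Valid) {c : ℕ} (hc : c < 2048) (d : ℕ) : D.mul c d < 2048 :=
  Nat.xor_lt_two_pow (n := 11) hc (h.act_lt (h.proj_lt c) d)

variable (D) in
/-- The coordinate permutation attached to a codeword. -/
noncomputable def perm (x : Word 15) : Equiv.Perm (Fin 15) :=
  matPerm (D.mat (xorComb D.proj (code x)))

theorem perm_word {c : ℕ} (hc : c < 2048) :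
    D.perm (word c) = matPerm (D.mat (xorComb D.proj c)) := by
  rw [perm, code_word hc]

theorem Valid.word_mul (h : D.Valid) {c : ℕ} (hc : c < 2048) (d : ℕ) :
    word (D.mul c d) = word c + word d ∘ D.perm (word c) := by
  rw [mul, word_xor, h.word_act (h.proj_lt c), perm_word hc]

theorem Valid.perm_mul (h : D.Valid) {c d : ℕ} (hc : c < 2048) (hd : d < 2048) :
    D.perm (word (D.mul c d)) = D.perm (word d) * D.perm (word c) := by
  rw [perm_word (h.mul_lt hc d), perm_word hc, perm_word hd, ← h.matPerm_mul (h.proj_lt c)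
    (h.proj_lt d), mul, xorComb_xor, h.proj_act (h.proj_lt c)]

theorem Valid.isCrossed (h : D.Valid) : IsCrossed hamming15 D.perm where
  mem x hx y hy := by
    obtain ⟨c, hc, rfl⟩ := exists_word hx
    obtain ⟨d, -, rfl⟩ := exists_word hy
    rw [perm_word hc, ← h.word_act (h.proj_lt c)]
    exact word_mem_hamming15 (h.act_lt (h.proj_lt c) d)
  mul x hx y hy := by
    obtain ⟨c, hc, rfl⟩ := exists_word hx
    obtain ⟨d, hd, rfl⟩ := exists_word hy
    rw [← h.word_mul hc, h.perm_mul hc hd]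

theorem Valid.graphGroup_mem (h : D.Valid) :
    graphGroup h.isCrossed ∈ embeddingRegularSubgroups 4 := by
  have hle : 2 ^ D.dim ≤ 8 := Nat.pow_le_pow_right two_pos h.1.1
  refine HammingRegular.graphGroup_mem h.isCrossed (fun x hx y hy => ?_) fun x hx => ?_
  · obtain ⟨c, hc, rfl⟩ := exists_word_of_mem_hadamard15 hx
    obtain ⟨d, hd, rfl⟩ := exists_word_of_mem_hadamard15 hy
    rw [perm_word (by omega), ← h.word_act (h.proj_lt c)]
    exact word_mem_hadamard15 ((h.2 _ (h.proj_lt c)).2.2.2.1 d hd)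
  · obtain ⟨c, hc, rfl⟩ := exists_word hx
    have hp := h.proj_lt c
    refine ⟨word (xorComb D.proj c), word_mem_hadamard15 (by omega), ?_⟩
    rw [perm_word (by omega), perm_word hc, h.1.2.2.2 _ hp]

/-- The group element numbered `c`. -/
noncomputable def Valid.element (h : D.Valid) (c : Fin 2048) : graphGroup h.isCrossed :=
  graphEquiv h.isCrossed (wordEquiv c)

theorem Valid.element_bijective (h : D.Valid) : Function.Bijective h.element :=
  (graphEquiv h.isCrossed).bijective.comp wordEquiv.bijective

theorem Valid.element_mul (h : D.Valid) (c d : Fin 2048) :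
    h.element c * h.element d = h.element ⟨D.mul c d, h.mul_lt c.2 d⟩ := by
  refine Subtype.ext ?_
  show wordAut (word c) (D.perm (word c)) * wordAut (word d) (D.perm (word d)) =
    wordAut (word (D.mul c d)) (D.perm (word (D.mul c d)))
  rw [wordAut_mul, h.perm_mul c.2 d.2, h.word_mul c.2]

theorem Valid.element_zero (h : D.Valid) : h.element 0 = 1 := by
  have h1 : D.mul 0 0 = 0 := by
    have hz : ∀ rs, xorComb rs 0 = 0 := fun rs => by simpa using xorComb_xor rs 0 0
    rw [mul, act, hz, Nat.xor_self]
  have h2 := h.element_mul 0 0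
  rw [show (⟨D.mul (0 : Fin 2048) (0 : Fin 2048), _⟩ : Fin 2048) = 0 from Fin.ext h1] at h2
  exact mul_eq_left.1 h2

end Datum

/-! ### Counting pairs of group elements -/

/-- The numbers of pairs `(x, y)` in a group such that `x² = y²`, such that `x² = 1` and `xy = yx`,
and such that `x² = y² = 1` and `xy = yx`. -/
noncomputable def pairInvariants (G : Type*) [Group G] : ℕ × ℕ × ℕ :=
  (Nat.card {q : G × G // q.1 * q.1 = q.2 * q.2},
    Nat.card {q : G × G // q.1 * q.1 = 1 ∧ q.1 * q.2 = q.2 * q.1},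
    Nat.card {q : G × G // q.1 * q.1 = 1 ∧ q.2 * q.2 = 1 ∧ q.1 * q.2 = q.2 * q.1})

theorem pairInvariants_congr {G G' : Type*} [Group G] [Group G'] (e : G ≃* G') :
    pairInvariants G = pairInvariants G' := by
  refine Prod.ext ?_ (Prod.ext ?_ ?_) <;>
  · refine Nat.card_congr ((e.toEquiv.prodCongr e.toEquiv).subtypeEquiv fun q => ?_)
    simp [← map_mul, ← map_one e, -map_one]

namespace Datum

variable (D : Datum)

/-- The columns of the map `c ↦ c + σ(c)`, whose values at the codewords with label `w` are the
squares of the corresponding group elements. -/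
def squareColumns (w : ℕ) : List ℕ := List.zipWith (· ^^^ ·) units (columns (D.mat w))

/-- The number of pairs of codewords with `A(c) = B(d)`, where the linear maps `A` and `B` depend on
the labels of `c` and `d`. -/
def countPairs (A B : ℕ → ℕ → List ℕ) : ℕ :=
  ((List.range (2 ^ D.dim)).map fun w => ((List.range (2 ^ D.dim)).map fun v =>
    countSolutions 22 (pairSystem D.proj (A w v) (B w v)) (pack 3 w (pack 3 v 0))).sum).sum

/-- The numbers `pairInvariants` of the group, in terms of the data. Elements `x`, `y` of labels
`w`, `v` commute if and only if `x + σ(v)(x) = y + σ(w)(y)`. -/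
def invariants : ℕ × ℕ × ℕ :=
  (D.countPairs (fun w _ => D.squareColumns w) fun _ v => D.squareColumns v,
    D.countPairs (fun w v => List.zipWith (pack 11) (D.squareColumns v) (D.squareColumns w))
      fun w _ => D.squareColumns w,
    D.countPairs (fun w v => List.zipWith (pack 11) (D.squareColumns v)
        ((D.squareColumns w).map (pack 11 0)))
      fun w v => List.zipWith (pack 11) (D.squareColumns w)
        ((D.squareColumns v).map (pack 11 · 0)))

variable {D}

theorem length_columns (m : ℕ) : (columns m).length = 11 := rfl

theorem length_squareColumns (w : ℕ) : (D.squareColumns w).length = 11 := by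
  rw [squareColumns, List.length_zipWith, length_columns]
  rfl

theorem xorComb_squareColumns (w : ℕ) {c : ℕ} (hc : c < 2048) :
    xorComb (D.squareColumns w) c = c ^^^ D.act w c := by
  rw [squareColumns, xorComb_zipWith (fun a b a' b' => by ac_rfl) (by rw [length_columns]; rfl),
    xorComb_units hc]
  rfl

theorem Valid.length_proj (h : D.Valid) : D.proj.length = 11 := by
  have h1 := h.1.1
  have h2 := h.1.2.1
  simp [proj, units, h2]
  omega

theorem sum_map_range (f : ℕ → ℕ) (n : ℕ) :
    ((List.range n).map f).sum = ∑ i ∈ Finset.range n, f i := rfl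

theorem Valid.countPairs_eq (h : D.Valid) {A B : ℕ → ℕ → List ℕ} (hA : ∀ w v, (A w v).length = 11)
    (hB : ∀ w v, (B w v).length = 11) : D.countPairs A B =
      ∑ c ∈ Finset.range 2048, ∑ d ∈ Finset.range 2048,
        if xorComb (A (xorComb D.proj c) (xorComb D.proj d)) c =
          xorComb (B (xorComb D.proj c) (xorComb D.proj d)) d then 1 else 0 := by
  have hle : 2 ^ D.dim ≤ 2 ^ 3 := Nat.pow_le_pow_right two_pos h.1.1
  rw [countPairs, sum_map_range]
  have h1 : ∀ w ∈ Finset.range (2 ^ D.dim), ((List.range (2 ^ D.dim)).map fun v =>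
      countSolutions 22 (pairSystem D.proj (A w v) (B w v)) (pack 3 w (pack 3 v 0))).sum =
      ∑ c ∈ Finset.range 2048, ∑ d ∈ Finset.range 2048, ∑ v ∈ Finset.range (2 ^ D.dim),
        if xorComb D.proj c = w ∧ xorComb D.proj d = v ∧ xorComb (A w v) c = xorComb (B w v) d
          then 1 else 0 := by
    intro w hw
    rw [sum_map_range]
    have h2 : ∀ v ∈ Finset.range (2 ^ D.dim),
        countSolutions 22 (pairSystem D.proj (A w v) (B w v)) (pack 3 w (pack 3 v 0)) = _ :=
      fun v hv => countSolutions_pairSystem h.length_proj (hA w v) (hB w v)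
        (fun r hr => (h.1.2.2.1 r hr).trans_le hle) ((Finset.mem_range.1 hw).trans_le hle)
        ((Finset.mem_range.1 hv).trans_le hle)
    rw [Finset.sum_congr rfl h2, Finset.sum_comm]
    exact Finset.sum_congr rfl fun c _ => Finset.sum_comm
  rw [Finset.sum_congr rfl h1, Finset.sum_comm]
  refine Finset.sum_congr rfl fun c _ => ?_
  rw [Finset.sum_comm]
  refine Finset.sum_congr rfl fun d _ => ?_
  rw [Finset.sum_eq_single_of_mem _ (Finset.mem_range.2 (h.proj_lt c)) fun w _ hw =>
      Finset.sum_eq_zero fun v _ => if_neg fun e => hw e.1.symm,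
    Finset.sum_eq_single_of_mem _ (Finset.mem_range.2 (h.proj_lt d)) fun v _ hv =>
      if_neg fun e => hv e.2.1.symm]
  simp

theorem Valid.card_pairs (h : D.Valid) {A B : ℕ → ℕ → List ℕ} (hA : ∀ w v, (A w v).length = 11)
    (hB : ∀ w v, (B w v).length = 11) {Q : graphGroup h.isCrossed → graphGroup h.isCrossed → Prop}
    (hQ : ∀ c d : Fin 2048, Q (h.element c) (h.element d) ↔
      xorComb (A (xorComb D.proj c) (xorComb D.proj d)) c =
        xorComb (B (xorComb D.proj c) (xorComb D.proj d)) d) :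
    Nat.card {q : graphGroup h.isCrossed × graphGroup h.isCrossed // Q q.1 q.2} =
      D.countPairs A B := by
  let e := Equiv.ofBijective _ h.element_bijective
  rw [h.countPairs_eq hA hB, ← Fin.sum_univ_eq_sum_range (fun c => ∑ d ∈ Finset.range 2048,
    if xorComb (A (xorComb D.proj c) (xorComb D.proj d)) c =
      xorComb (B (xorComb D.proj c) (xorComb D.proj d)) d then 1 else 0)]
  have h1 : ∀ c : Fin 2048, (∑ d ∈ Finset.range 2048,
      if xorComb (A (xorComb D.proj c) (xorComb D.proj d)) c =
        xorComb (B (xorComb D.proj c) (xorComb D.proj d)) d then 1 else 0) =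
      ∑ d : Fin 2048, if xorComb (A (xorComb D.proj c) (xorComb D.proj d)) c =
        xorComb (B (xorComb D.proj c) (xorComb D.proj d)) d then 1 else 0 := fun c =>
    (Fin.sum_univ_eq_sum_range (fun d => if xorComb (A (xorComb D.proj c) (xorComb D.proj d)) c =
      xorComb (B (xorComb D.proj c) (xorComb D.proj d)) d then 1 else 0) 2048).symm
  rw [Finset.sum_congr rfl fun c _ => h1 c, ← Fintype.sum_prod_type', ← Finset.card_filter,
    ← Fintype.card_subtype, ← Nat.card_eq_fintype_card]
  exact (Nat.card_congr ((e.prodCongr e).subtypeEquiv fun q => (hQ q.1 q.2).symm)).symm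

theorem Valid.commute_iff (h : D.Valid) (c d : Fin 2048) :
    h.element c * h.element d = h.element d * h.element c ↔
      xorComb (D.squareColumns (xorComb D.proj d)) c =
        xorComb (D.squareColumns (xorComb D.proj c)) d := by
  rw [h.element_mul, h.element_mul, h.element_bijective.1.eq_iff, Fin.mk.injEq,
    xorComb_squareColumns _ c.2, xorComb_squareColumns _ d.2, mul, mul]
  have key : ∀ a b x y : ℕ, a ^^^ b = x ^^^ y ↔ a ^^^ y = x ^^^ b := by
    intro a b x y
    rw [← Nat.xor_eq_zero_iff, ← Nat.xor_eq_zero_iff (x := a ^^^ y)]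
    have : a ^^^ b ^^^ (x ^^^ y) = a ^^^ y ^^^ (x ^^^ b) := by ac_rfl
    rw [this]
  exact key _ _ _ _

theorem Valid.square_eq (h : D.Valid) (c : Fin 2048) :
    h.element c * h.element c = h.element ⟨xorComb (D.squareColumns (xorComb D.proj c)) c, by
      rw [xorComb_squareColumns _ c.2]; exact h.mul_lt c.2 c⟩ := by
  rw [h.element_mul, h.element_bijective.1.eq_iff, Fin.mk.injEq, xorComb_squareColumns _ c.2, mul]

theorem Valid.square_eq_one_iff (h : D.Valid) (c : Fin 2048) :
    h.element c * h.element c = 1 ↔ xorComb (D.squareColumns (xorComb D.proj c)) c = 0 := by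
  rw [h.square_eq, ← h.element_zero, h.element_bijective.1.eq_iff, Fin.ext_iff]
  rfl

theorem Valid.squareColumns_lt (h : D.Valid) {w c : ℕ} (hw : w < 2 ^ D.dim) (hc : c < 2048) :
    xorComb (D.squareColumns w) c < 2 ^ 11 := by
  rw [xorComb_squareColumns _ hc]
  exact Nat.xor_lt_two_pow hc (h.act_lt hw c)

theorem Valid.pairInvariants_eq (h : D.Valid) :
    pairInvariants (graphGroup h.isCrossed) = D.invariants := by
  have hz : ∀ a b a' b', pack 11 (a ^^^ a') (b ^^^ b') = pack 11 a b ^^^ pack 11 a' b' :=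
    pack_xor 11
  have hm : ∀ a b, pack 11 0 (a ^^^ b) = pack 11 0 a ^^^ pack 11 0 b := fun a b => by
    rw [← pack_xor, Nat.xor_zero]
  have hm' : ∀ a b, pack 11 (a ^^^ b) 0 = pack 11 a 0 ^^^ pack 11 b 0 := fun a b => by
    rw [← pack_xor, Nat.xor_zero]
  have hl : ∀ w, (D.squareColumns w).length = 11 := length_squareColumns
  have hlt : ∀ (w : ℕ) (c : Fin 2048), xorComb (D.squareColumns (xorComb D.proj w)) c < 2 ^ 11 :=
    fun w c => h.squareColumns_lt (h.proj_lt w) c.2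
  have hx0 : ∀ x : ℕ, pack 11 x 0 = x := fun x => by simp [pack]
  refine Prod.ext ?_ (Prod.ext ?_ ?_)
  · refine h.card_pairs (Q := fun x y => x * x = y * y) (by simp [hl]) (by simp [hl]) fun c d => ?_
    rw [h.square_eq, h.square_eq, h.element_bijective.1.eq_iff, Fin.mk.injEq]
  · refine h.card_pairs (Q := fun x y => x * x = 1 ∧ x * y = y * x) (by simp [hl]) (by simp [hl])
      fun c d => ?_
    rw [h.square_eq_one_iff, h.commute_iff, xorComb_zipWith hz (by rw [hl, hl])]
    conv_rhs => rhs; rw [← hx0 (xorComb _ _)]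
    rw [pack_inj (hlt d c) (hlt c d), and_comm]
  · refine h.card_pairs (Q := fun x y => x * x = 1 ∧ y * y = 1 ∧ x * y = y * x) (by simp [hl])
      (by simp [hl]) fun c d => ?_
    rw [h.square_eq_one_iff, h.square_eq_one_iff, h.commute_iff,
      xorComb_zipWith hz (by simp [hl]), xorComb_zipWith hz (by simp [hl]), xorComb_map hm,
      xorComb_map hm', pack_inj (hlt d c) (hlt c d), pack_inj (Nat.two_pow_pos 11) (hlt d d)]
    constructor
    · rintro ⟨a, b, e⟩
      exact ⟨e, b.symm, a⟩
    · rintro ⟨e, b, a⟩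
      exact ⟨a, b.symm, e⟩

end Datum

/-! ### 48 pairwise non-isomorphic groups -/

/-- Data with the same matrices and various projections. -/
def family (dim : ℕ) (mats : List ℕ) (quads : List (List ℕ)) : List Datum :=
  quads.map (Datum.mk dim mats)

/-- Data for representatives of 48 isomorphism classes. -/
def representatives : List Datum :=
  family 0 [0x8421]
    [[0, 0, 0, 0, 0, 0, 0]] ++
  family 1 [0x8421, 0x8423]
    [[0, 0, 0, 0, 0, 0, 0], [0, 1, 0, 1, 0, 0, 0]] ++
  family 1 [0x8421, 0x4823]
    [[0, 0, 0, 0, 0, 0, 0], [0, 1, 1, 1, 0, 0, 0]] ++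
  family 2 [0x8421, 0x8461, 0x84a1, 0x84e1]
    [[0, 1, 0, 0, 2, 0, 0], [0, 0, 0, 0, 0, 0, 0], [0, 0, 0, 0, 1, 3, 0],
     [2, 0, 0, 0, 0, 1, 0]] ++
  family 2 [0x8421, 0x8461, 0x84a5, 0x84e5]
    [[0, 1, 0, 0, 0, 2, 0], [0, 0, 0, 0, 0, 0, 0]] ++
  family 2 [0x8421, 0x8425, 0x8469, 0x846d]
    [[0, 0, 0, 0, 0, 0, 0], [0, 1, 0, 1, 0, 0, 0]] ++
  family 2 [0x8421, 0x8452, 0x8416, 0x8465]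
    [[0, 0, 0, 0, 0, 0, 0]] ++
  family 2 [0x8421, 0x8425, 0x84a5, 0x84a1]
    [[0, 3, 1, 0, 0, 2, 0], [0, 0, 0, 0, 0, 0, 0], [0, 0, 2, 0, 0, 2, 0],
     [0, 2, 0, 0, 0, 2, 0], [0, 1, 1, 0, 0, 0, 0]] ++
  family 2 [0x8421, 0x8461, 0x8429, 0x8469]
    [[0, 0, 0, 1, 2, 0, 0], [0, 0, 0, 1, 1, 0, 0], [0, 0, 0, 3, 0, 0, 0]] ++
  family 2 [0x8421, 0x8461, 0x8469, 0x8429]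
    [[0, 3, 0, 1, 2, 0, 0]] ++
  family 2 [0x8421, 0x8425, 0x84a1, 0x84a5]
    [[0, 0, 1, 0, 0, 2, 0]] ++
  family 2 [0x8421, 0x84a5, 0x846d, 0x84e9]
    [[0, 2, 2, 1, 1, 3, 0], [3, 1, 2, 2, 2, 0, 0], [0, 3, 1, 2, 2, 3, 0],
     [1, 2, 2, 2, 2, 0, 0], [0, 0, 2, 0, 0, 2, 0], [1, 1, 0, 0, 0, 0, 0],
     [0, 2, 1, 0, 0, 1, 0], [0, 1, 0, 0, 0, 0, 0], [0, 3, 2, 3, 3, 1, 0]] ++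
  family 2 [0x8421, 0x84a5, 0x84e9, 0x846d]
    [[0, 0, 0, 0, 0, 0, 0]] ++
  family 2 [0x8421, 0x4852, 0x481a, 0x84a5]
    [[0, 0, 1, 0, 0, 2, 0], [3, 3, 1, 0, 0, 2, 0], [0, 0, 0, 0, 0, 0, 0],
     [0, 3, 2, 0, 0, 1, 0]] ++
  family 3 [0x8421, 0x8c21, 0x84a1, 0x8ca1, 0x8ca9, 0x84a9, 0x8c29, 0x8429]
    [[0, 0, 0, 0, 2, 0, 0]] ++
  family 3 [0x8421, 0x8492, 0x841a, 0x84a9, 0x8ca9, 0x8c1a, 0x8c92, 0x8c21]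
    [[4, 0, 0, 0, 0, 0, 0]] ++
  family 3 [0x8421, 0x8c21, 0x8124, 0x812c, 0x8429, 0x8c29, 0x8924, 0x892c]
    [[0, 0, 0, 0, 0, 0, 0]] ++
  family 3 [0x8421, 0x8c21, 0x81a4, 0x81ac, 0x8429, 0x8c29, 0x89a4, 0x89ac]
    [[0, 0, 0, 0, 0, 0, 0]] ++
  family 3 [0x8421, 0x8621, 0x81a4, 0x81a6, 0x842b, 0x8ba6, 0x8ba4, 0x862b]
    [[0, 0, 2, 1, 4, 2, 4], [0, 0, 0, 1, 4, 2, 4], [2, 0, 2, 1, 4, 2, 4]] ++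
  family 3 [0x8421, 0x8c52, 0x84ad, 0x84e5, 0x8cd6, 0x8469, 0x8c1e, 0x8c9a]
    [[4, 1, 6, 1, 3, 2, 4], [0, 1, 6, 1, 3, 2, 4], [0, 5, 6, 1, 3, 2, 4]]

theorem length_representatives : representatives.length = 48 := by
  decide +kernel

theorem valid_of_mem_representatives : ∀ D ∈ representatives, D.Valid := by
  decide +kernel

theorem nodup_invariants_representatives : (representatives.map Datum.invariants).Nodup := by
  decide +kernel

theorem le_ncard_embeddingIsoClasses : 48 ≤ (embeddingIsoClasses 4).ncard := by
  have hv : ∀ i : Fin representatives.length, (representatives.get i).Valid := fun i =>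
    valid_of_mem_representatives _ (List.get_mem _ i)
  let f : Fin representatives.length → Quotient (isoSetoid (Equiv.Perm (Word (2 ^ 4 - 1)))) :=
    fun i => Quotient.mk _ (graphGroup (hv i).isCrossed)
  have hf : Function.Injective f := by
    intro i k hik
    obtain ⟨e⟩ : Nonempty (graphGroup (hv i).isCrossed ≃* graphGroup (hv k).isCrossed) :=
      Quotient.exact hik
    have h1 := pairInvariants_congr e
    rw [(hv i).pairInvariants_eq, (hv k).pairInvariants_eq] at h1
    have h2 := List.nodup_iff_injective_get.1 nodup_invariants_representatives
    have h3 := @h2 (i.cast (List.length_map ..).symm) (k.cast (List.length_map ..).symm)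
      (by simpa using h1)
    exact Fin.ext (congrArg Fin.val h3)
  have h1 : Set.range f ⊆ embeddingIsoClasses 4 := by
    rintro _ ⟨i, rfl⟩
    exact ⟨_, (hv i).graphGroup_mem, rfl⟩
  have h2 := Set.ncard_le_ncard h1 (Set.toFinite _)
  rwa [← Set.image_univ, Set.ncard_image_of_injective _ hf, Set.ncard_univ, Nat.card_fin,
    length_representatives] at h2

end HammingRegular

theorem mainTheorem6 :
    1207 ≤ (embeddingConjClasses 4).ncard ∧ 48 ≤ (embeddingIsoClasses 4).ncard :=
  ⟨HammingRegular.le_ncard_embeddingConjClasses, HammingRegular.le_ncard_embeddingIsoClasses⟩
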